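/- Let $M$ and $N$ be smooth manifolds of the same dimension. Let $\Phi$ be a smooth (possibly infinite-dimensional, diffeological) space with a smooth right action $(\phi,\psi)\mapsto R_\psi\phi=\phi^\psi$ of $\mathrm{Diff}(M)$, so that $(\phi^{\psi})^{\psi'}=\phi^{\psi\circ\psi'}$; for instance a space of tensor fields on $M$ with $\phi^\psi=\psi^*\phi$. For $X=\tfrac{d}{d\tau}\psi_\tau|_{\tau=0}$, with $\psi_\tau$ a smooth curve in $\mathrm{Diff}(M)$ and $\psi_0=\mathrm{id}$, let $X^v_{|\phi}=\tfrac{d}{d\tau}\phi^{\psi_\tau}|_{\tau=0}$. Let $\mathrm{Diff}_r(M)$ be a subgroup of $\mathrm{Diff}(M)$, and let $\mathfrak{diff}_r(M)$ be the set of the $X$ obtained from curves in $\mathrm{Diff}_r(M)$. Let $C:\Phi\times\mathrm{Diff}_r(M)\to\mathrm{Diff}(N)$ be a smooth 1-cocycle, $$C(\phi;\psi'\circ\psi)=C(\phi;\psi')\circ C(\phi^{\psi'};\psi),$$ and put $a(X;\phi)=\tfrac{d}{d\tau}C(\phi;\psi_\tau)|_{\tau=0}$. Let $u:\Phi\to\mathrm{Diff}(N,M)$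 be a smooth map such that $$R_\psi^\star u=\psi^{-1}\circ u\circ C(\cdot\,;\psi)\qquad\text{for all }\psi\in\mathrm{Diff}_r(M).$$ Let $\rho$ be a smooth representation of $\mathrm{Diff}(M)$ on a vector space $V$, of $\mathrm{Diff}(N)$ on a vector space $W$, and of $\mathrm{Diff}(N,M)$ by isomorphisms $W\to V$, compatible with compositions (for example tensors on $M$ and on $N$, with $\rho(u)^{-1}=u^*$). 1. Let $\alpha$ be a $V$-valued $k$-form on $\Phi$ that is $\rho$-tensorial: $\iota_{X^v}\alpha=0$ for all $X\in\mathfrak{diff}(M)$ and $R_\psi^\star\alpha=\rho(\psi)^{-1}\alpha$ for all $\psi\in\mathrm{Diff}(M)$. Then its dressing $\alpha^u=\rho(u)^{-1}\alpha$ is a twisted tensorial $W$-valued $k$-form: it is a smooth form, $\iota_{X^v}\alpha^u=0$ for all $X\in\mathfrak{diff}_r(M)$, and $R_\psi^\star\alpha^u=\rho(C(\cdot\,;\psi))^{-1}\alpha^u$ for all $\psi\in\mathrm{Diff}_r(M)$. 2. Let $\omega$ be an Ehresmann connection on $\Phi$: a smooth $1$-form with values in the vector fields of $M$ such that $\omega(X^v)=X$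 for all $X\in\mathfrak{diff}(M)$ and $R_\psi^\star\omega=\psi^{-1}_*\,\omega\circ\psi$ for all $\psi\in\mathrm{Diff}(M)$. Then its dressing $\omega^u=u^{-1}_*\,\omega\circ u+u^{-1}_*\,du$ is a twisted connection: a smooth $1$-form with values in the vector fields of $N$ such that $\omega^u(X^v)=a(X;\cdot)$ for all $X\in\mathfrak{diff}_r(M)$ and $$R_\psi^\star\omega^u=C(\cdot\,;\psi)^{-1}_*\,\omega^u\circ C(\cdot\,;\psi)+C(\cdot\,;\psi)^{-1}_*\,dC(\cdot\,;\psi)\qquad\text{for all }\psi\in\mathrm{Diff}_r(M).$$ 3. For every smooth map $\boldsymbol\psi:\Phi\to\mathrm{Diff}_r(M)$, let $\Xi(\phi)=\phi^{\boldsymbol\psi(\phi)}$, let $\beta^{\boldsymbol\psi}=\Xi^\star\beta$ for forms $\beta$ on $\Phi$, and let $C(\boldsymbol\psi):\phi\mapsto C(\phi;\boldsymbol\psi(\phi))$. Then, for $\alpha$ and $\omega$ as above, $$(\alpha^u)^{\boldsymbol\psi}=\rho\big(C(\boldsymbol\psi)\big)^{-1}\alpha^u,\qquad (\omega^u)^{\boldsymbol\psi}=C(\boldsymbol\psi)^{-1}_*\,\omega^u\circ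 C(\boldsymbol\psi)+C(\boldsymbol\psi)^{-1}_*\,dC(\boldsymbol\psi).$$ -/

import Mathlib

open scoped Manifold ContDiff

/-! Smooth spaces are diffeological spaces: this covers the infinite-dimensional manifolds of the
convenient calculus, in particular spaces of smooth fields on a manifold, groups of diffeomorphisms
and spaces of diffeomorphisms between two manifolds. -/

namespace FieldSpace

open Diffeology

/-- The parameter spaces `ℝⁿ` of plots. -/
abbrev E (n : ℕ) : Type := EuclideanSpace ℝ (Fin n)

/-! ### Diffeomorphism groups -/

/-- `Diff(M, N)`: smooth diffeomorphisms between two smooth manifolds of dimension `d`. -/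
abbrev Diffeo (d : ℕ) (M N : Type*) [TopologicalSpace M] [ChartedSpace (E d) M]
    [TopologicalSpace N] [ChartedSpace (E d) N] : Type _ :=
  Diffeomorph (𝓡 d) (𝓡 d) M N ∞

section Diffeo

variable {d : ℕ} {M N : Type*} [TopologicalSpace M] [ChartedSpace (E d) M]
  [TopologicalSpace N] [ChartedSpace (E d) N]

/-- `Diff(M)` as a group; the product is the composition of maps. -/
noncomputable instance : Group (Diffeo d M M) where
  mul g f := f.trans g
  one := Diffeomorph.refl (𝓡 d) M ∞
  inv f := f.symm
  mul_assoc _ _ _ := rfl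
  one_mul _ := rfl
  mul_one _ := rfl
  inv_mul_cancel f := Diffeomorph.self_trans_symm f

/-- A family of maps `ℝⁿ → (M → N)` that is jointly smooth over an open set of parameters. -/
def JointlySmoothOn (d : ℕ) {M N : Type*} [TopologicalSpace M] [ChartedSpace (E d) M]
    [TopologicalSpace N] [ChartedSpace (E d) N] {n : ℕ} (U : Set (E n)) (p : E n → M → N) : Prop :=
  ContMDiffOn (𝓘(ℝ, E n).prod (𝓡 d)) (𝓡 d) ∞ (fun q : E n × M => p q.1 q.2) (U ×ˢ Set.univ)

theorem JointlySmoothOn.congr {n : ℕ} {U : Set (E n)} {p q : E n → M → N}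
    (hp : JointlySmoothOn d U p) (h : ∀ r ∈ U, q r = p r) : JointlySmoothOn d U q :=
  ContMDiffOn.congr hp fun x hx => by rw [h x.1 hx.1]

theorem JointlySmoothOn.reparam {n m : ℕ} {U : Set (E n)} {V : Set (E m)} {p : E n → M → N}
    (hp : JointlySmoothOn d U p) {f : E m → E n} (hf : ContDiffOn ℝ ∞ f V)
    (h : Set.MapsTo f V U) : JointlySmoothOn d V (p ∘ f) := by
  have h1 : ContMDiffOn (𝓘(ℝ, E m).prod (𝓡 d)) (𝓘(ℝ, E n).prod (𝓡 d)) ∞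
      (fun q : E m × M => (f q.1, q.2)) (V ×ˢ Set.univ) :=
    ContMDiffOn.prodMk
      (hf.contMDiffOn.comp contMDiff_fst.contMDiffOn fun x hx => hx.1) contMDiff_snd.contMDiffOn
  exact ContMDiffOn.comp hp h1 fun x hx => ⟨h hx.1, trivial⟩

theorem JointlySmoothOn.const {n : ℕ} {U : Set (E n)} {f : M → N}
    (hf : ContMDiff (𝓡 d) (𝓡 d) ∞ f) : JointlySmoothOn d U (fun _ : E n => f) :=
  (hf.comp contMDiff_snd).contMDiffOn

theorem JointlySmoothOn.locality {n : ℕ} {U : Set (E n)} {p : E n → M → N}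
    (h : ∀ x ∈ U, ∃ V : Set (E n), IsOpen V ∧ x ∈ V ∧ JointlySmoothOn d V p) :
    JointlySmoothOn d U p := by
  intro x hx
  obtain ⟨V, hV, hxV, hp⟩ := h x.1 hx.1
  exact ((hp x ⟨hxV, trivial⟩).contMDiffAt
    ((hV.prod isOpen_univ).mem_nhds ⟨hxV, trivial⟩)).contMDiffWithinAt

/-- The functional diffeology on `Diff(M, N)`: a family of diffeomorphisms is a plot when it and
the family of inverses are jointly smooth in the parameter and the point. -/
instance : DiffeologicalSpace (Diffeo d M N) :=
  .ofCorePlotsOn {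
    isPlotOn := fun {_ u} _ p =>
      JointlySmoothOn d u (fun r => p r) ∧ JointlySmoothOn d u (fun r => (p r).symm)
    isPlotOn_congr := fun _ _ _ h =>
      ⟨fun ⟨h1, h2⟩ => ⟨h1.congr fun r hr => by rw [h hr], h2.congr fun r hr => by rw [h hr]⟩,
        fun ⟨h1, h2⟩ => ⟨h1.congr fun r hr => by rw [h hr], h2.congr fun r hr => by rw [h hr]⟩⟩
    isPlot_const := fun g => ⟨.const g.contMDiff, .const g.symm.contMDiff⟩
    isPlotOn_reparam := fun _ _ _ h hp hf => ⟨hp.1.reparam hf h, hp.2.reparam hf h⟩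
    locality := fun _ _ h =>
      ⟨.locality fun x hx => let ⟨v, hv, hxv, hp⟩ := h x hx; ⟨v, hv, hxv, hp.1⟩,
        .locality fun x hx => let ⟨v, hv, hxv, hp⟩ := h x hx; ⟨v, hv, hxv, hp.2⟩⟩ }

end Diffeo

/-! ### Field space -/

/-- A smooth right action of `Diff(M)` on a smooth space `Φ`. The field `φ` transformed by `ψ`,
`R_ψ φ = φ^ψ`, is `MulOpposite.op ψ • φ`, so that `(φ^ψ)^ψ' = φ^(ψ ∘ ψ')`. -/
class SmoothRightAction (d : ℕ) (M : Type*) [TopologicalSpace M] [ChartedSpace (E d) M]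
    (Φ : Type*) [DiffeologicalSpace Φ] [MulAction (Diffeo d M M)ᵐᵒᵖ Φ] : Prop where
  smooth : ∀ {n : ℕ} {P : E n → Φ} {g : E n → Diffeo d M M}, IsPlot P → IsPlot g →
    IsPlot fun r => MulOpposite.op (g r) • P r

/-- The smooth maps `ℝⁿ → X`. -/
structure Plot (X : Type*) [DiffeologicalSpace X] (n : ℕ) where
  toFun : E n → X
  isPlot : IsPlot toFun

namespace Plot

variable {X : Type*} [DiffeologicalSpace X] {n m : ℕ}

instance : CoeFun (Plot X n) fun _ => E n → X := ⟨toFun⟩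

/-- The plot `P ∘ f`, for a smooth reparametrisation `f`. -/
def reparam (P : Plot X m) (f : E n → E m) (hf : ContDiff ℝ ∞ f) : Plot X n :=
  ⟨P ∘ f, isPlot_reparam P.isPlot hf⟩

/-- The plot `F ∘ P`, for a smooth map `F`. -/
def map {Y : Type*} [DiffeologicalSpace Y] (P : Plot X n) (F : X → Y) (hF : DSmooth F) :
    Plot Y n :=
  ⟨F ∘ P, hF n P P.isPlot⟩

end Plot

section Action

variable {d : ℕ} {M : Type*} [TopologicalSpace M] [ChartedSpace (E d) M]
  {Φ : Type*} [DiffeologicalSpace Φ] [MulAction (Diffeo d M M)ᵐᵒᵖ Φ]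

/-- The right translation `R_ψ : φ ↦ φ^ψ`. -/
def rightAct (ψ : Diffeo d M M) (φ : Φ) : Φ := MulOpposite.op ψ • φ

/-- The vertical map `Ξ : φ ↦ φ^(ψ(φ))` generated by a field-dependent diffeomorphism. -/
def vertical (ψ : Φ → Diffeo d M M) (φ : Φ) : Φ := rightAct (ψ φ) φ

theorem dSmooth_rightAct [SmoothRightAction d M Φ] (ψ : Diffeo d M M) :
    DSmooth (rightAct ψ : Φ → Φ) :=
  fun _ _ hP => SmoothRightAction.smooth hP isPlot_const

theorem dSmooth_vertical [SmoothRightAction d M Φ] {ψ : Φ → Diffeo d M M} (hψ : DSmooth ψ) :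
    DSmooth (vertical ψ) :=
  fun n P hP => SmoothRightAction.smooth hP (hψ n P hP)

/-- At the parameter `r`, the velocity of the plot `Q` in the direction `e` is the fundamental
vertical vector `X^v` at `Q r` generated by the velocity `X` of the family `g` of diffeomorphisms
(with `g r = id`) in the direction `e`: `Q` is of the form `s ↦ R_{g(s)} P(f(s))`, where `f` has
zero derivative at `r` in the direction `e`. -/
structure IsFundamental {n : ℕ} (Q : Plot Φ n) (r e : E n) (g : E n → Diffeo d M M) : Prop where
  isPlot : IsPlot g
  base : g r = 1
  exists_eq : ∃ (m : ℕ) (P : Plot Φ m) (f : E n → E m), ContDiff ℝ ∞ f ∧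
    fderiv ℝ f r e = 0 ∧ ∀ s, Q s = rightAct (g s) (P (f s))

end Action

/-! ### Forms with values in a vector space -/

/-- A vector space with smooth operations. -/
class DiffeologicalModule (V : Type*) [AddCommGroup V] [Module ℝ V] [DiffeologicalSpace V] :
    Prop where
  isPlot_add : ∀ {n : ℕ} {p q : E n → V}, IsPlot p → IsPlot q → IsPlot fun r => p r + q r
  isPlot_smul : ∀ {n : ℕ} {a : E n → ℝ} {p : E n → V}, ContDiff ℝ ∞ a → IsPlot p →
    IsPlot fun r => a r • p r

/-- The data of a `V`-valued `k`-form on `Φ`: for each plot `P`, the pullback of the form to the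
parameter space. The laws of a form are in `IsForm`. -/
def FormData (Φ : Type*) [DiffeologicalSpace Φ] (V : Type*) [AddCommGroup V] [Module ℝ V]
    (k : ℕ) : Type _ :=
  ∀ ⦃n : ℕ⦄, Plot Φ n → E n → (E n) [⋀^Fin k]→ₗ[ℝ] V

section Forms

variable {Φ : Type*} [DiffeologicalSpace Φ] {V : Type*} [AddCommGroup V] [Module ℝ V] {k : ℕ}

/-- `α ∈ Ω^k(Φ, V)`: smooth on each plot and compatible with reparametrisations. -/
structure IsForm [DiffeologicalSpace V] (α : FormData Φ V k) : Prop where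
  smooth : ∀ ⦃n : ℕ⦄ (P : Plot Φ n) (v : Fin k → E n), IsPlot fun r => α P r v
  reparam : ∀ ⦃n m : ℕ⦄ (P : Plot Φ m) (f : E n → E m) (hf : ContDiff ℝ ∞ f) (r : E n),
    α (P.reparam f hf) r = (α P (f r)).compLinearMap (fderiv ℝ f r).toLinearMap

/-- The pullback `F^⋆ α`. -/
def FormData.pullback (F : Φ → Φ) (hF : DSmooth F) (α : FormData Φ V k) : FormData Φ V k :=
  fun _ P r => α (P.map F hF) r

end Forms

/-! ### One-forms with values in vector fields -/

/-- The data of a one-form on `Φ` with values in the vector fields of `M`: for each plot `P` and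
parameter `r`, the vector field `x ↦ A P r x v` depends linearly on the velocity `v`. -/
def VFormData (Φ : Type*) [DiffeologicalSpace Φ] (d : ℕ) (M : Type*) [TopologicalSpace M]
    [ChartedSpace (E d) M] : Type _ :=
  ∀ ⦃n : ℕ⦄, Plot Φ n → E n → ∀ x : M, E n →L[ℝ] TangentSpace (𝓡 d) x

section VForms

variable {Φ : Type*} [DiffeologicalSpace Φ] {d : ℕ} {M N : Type*}
  [TopologicalSpace M] [ChartedSpace (E d) M] [TopologicalSpace N] [ChartedSpace (E d) N]

/-- `A ∈ Ω¹(Φ, diff(M))`: jointly smooth in the parameter and the point of `M` on each plot, and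
compatible with reparametrisations. -/
structure IsVForm [IsManifold (𝓡 d) ∞ M] (A : VFormData Φ d M) : Prop where
  smooth : ∀ ⦃n : ℕ⦄ (P : Plot Φ n) (v : E n),
    ContMDiff (𝓘(ℝ, E n).prod (𝓡 d)) (𝓡 d).tangent ∞
      (fun q : E n × M => (⟨q.2, A P q.1 q.2 v⟩ : TangentBundle (𝓡 d) M))
  reparam : ∀ ⦃n m : ℕ⦄ (P : Plot Φ m) (f : E n → E m) (hf : ContDiff ℝ ∞ f) (r : E n) (x : M),
    A (P.reparam f hf) r x = (A P (f r) x).comp (fderiv ℝ f r)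

/-- The pullback `F^⋆ A`. -/
def VFormData.pullback (F : Φ → Φ) (hF : DSmooth F) (A : VFormData Φ d M) : VFormData Φ d M :=
  fun _ P r => A (P.map F hF) r

/-- The form `g⁻¹_* A ∘ g`, for `g : Φ → Diff(N, M)`. -/
noncomputable def conj (g : Φ → Diffeo d N M) (A : VFormData Φ d M) : VFormData Φ d N :=
  fun _ P r y => (mfderiv (𝓡 d) (𝓡 d) (g (P r)) y).inverse.comp (A P r (g (P r) y))

/-- The form `g⁻¹_* dg`, for `g : Φ → Diff(N, M)`. -/
noncomputable def maurerCartan (g : Φ → Diffeo d N M) : VFormData Φ d N :=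
  fun n P r y => (mfderiv (𝓡 d) (𝓡 d) (g (P r)) y).inverse.comp
    (mfderiv 𝓘(ℝ, E n) (𝓡 d) (fun s => g (P s) y) r)

/-- The form `g⁻¹_* A ∘ g + g⁻¹_* dg`, for `g : Φ → Diff(N, M)`. -/
noncomputable def transform (g : Φ → Diffeo d N M) (A : VFormData Φ d M) : VFormData Φ d N :=
  fun _ P r y => conj g A P r y + maurerCartan g P r y

end VForms

/-! ### Representations, tensorial forms, connections -/

section Bundle

variable (d : ℕ) (M N : Type*) [TopologicalSpace M] [ChartedSpace (E d) M]
  [TopologicalSpace N] [ChartedSpace (E d) N]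

/-- A smooth representation `ρ` of the diffeomorphisms of `M` on `V`, of those of `N` on `W`, and
of the diffeomorphisms `N → M` by isomorphisms `W → V`, compatible with all compositions; such as
the tensors of a given type on `M` and on `N`, with `ρ(u)⁻¹ = u^*`. -/
structure NaturalRep (V W : Type*) [AddCommGroup V] [Module ℝ V] [DiffeologicalSpace V]
    [AddCommGroup W] [Module ℝ W] [DiffeologicalSpace W] where
  onM : Representation ℝ (Diffeo d M M) V
  onN : Representation ℝ (Diffeo d N N) W
  cross : Diffeo d N M → W ≃ₗ[ℝ] V
  cross_left : ∀ (ψ : Diffeo d M M) (u : Diffeo d N M) (w : W),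
    cross (u.trans ψ) w = onM ψ (cross u w)
  cross_right : ∀ (u : Diffeo d N M) (c : Diffeo d N N) (w : W),
    cross (c.trans u) w = cross u (onN c w)
  smooth_onM : ∀ {n : ℕ} {g : E n → Diffeo d M M} {v : E n → V}, IsPlot g → IsPlot v →
    IsPlot fun r => onM (g r) (v r)
  smooth_onN : ∀ {n : ℕ} {g : E n → Diffeo d N N} {w : E n → W}, IsPlot g → IsPlot w →
    IsPlot fun r => onN (g r) (w r)
  smooth_cross : ∀ {n : ℕ} {u : E n → Diffeo d N M} {w : E n → W}, IsPlot u → IsPlot w →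
    IsPlot fun r => cross (u r) (w r)
  smooth_cross_symm : ∀ {n : ℕ} {u : E n → Diffeo d N M} {v : E n → V}, IsPlot u → IsPlot v →
    IsPlot fun r => (cross (u r)).symm (v r)

/-- A smooth one-cocycle `C : Φ × R → Diff(N)` for the action on `Φ` of a subgroup `R` of
`Diff(M)`. In the application `R` is the residual group `Diff_r(M) = Diff(M) / Diff_0(M)`, either
realised as a subgroup complementary to `Diff_0(M)`, or through `R = ⊤` and cocycles and equations
that are trivial along `Diff_0(M)`. -/
structure OneCocycle (Φ : Type*) [DiffeologicalSpace Φ] [MulAction (Diffeo d M M)ᵐᵒᵖ Φ]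
    (R : Subgroup (Diffeo d M M)) where
  toFun : Φ → R → Diffeo d N N
  smooth : ∀ {n : ℕ} {P : E n → Φ} {g : E n → R}, IsPlot P →
    IsPlot (fun r => (g r : Diffeo d M M)) → IsPlot fun r => toFun (P r) (g r)
  cocycle : ∀ (φ : Φ) (ψ' ψ : R),
    toFun φ (ψ' * ψ) = toFun φ ψ' * toFun (rightAct (ψ' : Diffeo d M M) φ) ψ

variable {d M N}
variable {Φ : Type*} [DiffeologicalSpace Φ] [MulAction (Diffeo d M M)ᵐᵒᵖ Φ]
  {R : Subgroup (Diffeo d M M)}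
  {V W : Type*} [AddCommGroup V] [Module ℝ V] [DiffeologicalSpace V]
  [AddCommGroup W] [Module ℝ W] [DiffeologicalSpace W] {k : ℕ}

instance : CoeFun (OneCocycle d M N Φ R) fun _ => Φ → R → Diffeo d N N := ⟨OneCocycle.toFun⟩

/-- The map `C(ψ) : Φ → Diff(N)`, `φ ↦ C(φ; ψ(φ))`, for `ψ : Φ → R`. -/
def OneCocycle.along (C : OneCocycle d M N Φ R) (ψ : Φ → R) (φ : Φ) : Diffeo d N N := C φ (ψ φ)

/-- `α ∈ Ω_tens(Φ, ρ)`: horizontal, with equivariance `R_ψ^⋆ α = ρ(ψ)⁻¹ α` under `Diff(M)`. -/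
structure IsTensorial [SmoothRightAction d M Φ] (ρ : NaturalRep d M N V W)
    (α : FormData Φ V k) : Prop where
  isForm : IsForm α
  horizontal : ∀ {n : ℕ} (Q : Plot Φ n) (r e : E n) (g : E n → Diffeo d M M),
    IsFundamental Q r e g → ∀ (v : Fin k → E n) (i : Fin k), v i = e → α Q r v = 0
  equivariant : ∀ (ψ : Diffeo d M M) {n : ℕ} (P : Plot Φ n) (r : E n),
    α.pullback (rightAct ψ) (dSmooth_rightAct ψ) P r = (ρ.onM ψ⁻¹).compAlternatingMap (α P r)

/-- `α ∈ Ω_tens(Φ, C)` for the structure group `R`: horizontal, with the twisted equivariance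
`R_ψ^⋆ α = ρ(C(·; ψ))⁻¹ α`. -/
structure IsTwistedTensorial [SmoothRightAction d M Φ] (ρ : NaturalRep d M N V W)
    (C : OneCocycle d M N Φ R) (α : FormData Φ W k) : Prop where
  isForm : IsForm α
  horizontal : ∀ {n : ℕ} (Q : Plot Φ n) (r e : E n) (g : E n → R),
    IsFundamental Q r e (fun s => (g s : Diffeo d M M)) →
      ∀ (v : Fin k → E n) (i : Fin k), v i = e → α Q r v = 0
  equivariant : ∀ (ψ : R) {n : ℕ} (P : Plot Φ n) (r : E n),
    α.pullback (rightAct (ψ : Diffeo d M M)) (dSmooth_rightAct _) P r =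
      (ρ.onN (C (P r) ψ)⁻¹).compAlternatingMap (α P r)

/-- The dressing `α^u = ρ(u)⁻¹ α` of a tensorial form. -/
def dressForm (ρ : NaturalRep d M N V W) (u : Φ → Diffeo d N M) (α : FormData Φ V k) :
    FormData Φ W k :=
  fun _ P r => (ρ.cross (u (P r))).symm.toLinearMap.compAlternatingMap (α P r)

/-- The dressing `A^u = u⁻¹_* A ∘ u + u⁻¹_* du` of a connection. -/
noncomputable def dressConnection (u : Φ → Diffeo d N M) (A : VFormData Φ d M) :
    VFormData Φ d N :=
  transform u A

/-- Ehresmann connections on `Φ`: `A(X^v) = X` and `R_ψ^⋆ A = ψ⁻¹_* A ∘ ψ`, for the structure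
group `Diff(M)`. -/
structure IsEhresmann [IsManifold (𝓡 d) ∞ M] [SmoothRightAction d M Φ] (A : VFormData Φ d M) :
    Prop where
  isVForm : IsVForm A
  vertical : ∀ {n : ℕ} (Q : Plot Φ n) (r e : E n) (g : E n → Diffeo d M M),
    IsFundamental Q r e g → ∀ x : M,
      A Q r x e = mfderiv 𝓘(ℝ, E n) (𝓡 d) (fun s => g s x) r e
  equivariant : ∀ ψ : Diffeo d M M,
    A.pullback (rightAct ψ) (dSmooth_rightAct ψ) = conj (fun _ => ψ) A

/-- Twisted connections on `Φ` for the structure group `R` and the cocycle `C`: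
`ϖ(X^v) = a(X; ·)`, where `a(X; φ)` is the velocity of `C(φ; ψ_τ)` for a family `ψ_τ` in `R` with
velocity `X` at the identity, and
`R_ψ^⋆ ϖ = C(·; ψ)⁻¹_* ϖ ∘ C(·; ψ) + C(·; ψ)⁻¹_* dC(·; ψ)`. -/
structure IsTwistedConnection [IsManifold (𝓡 d) ∞ N] [SmoothRightAction d M Φ]
    (C : OneCocycle d M N Φ R) (ϖ : VFormData Φ d N) : Prop where
  isVForm : IsVForm ϖ
  vertical : ∀ {n : ℕ} (Q : Plot Φ n) (r e : E n) (g : E n → R),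
    IsFundamental Q r e (fun s => (g s : Diffeo d M M)) → ∀ y : N,
      ϖ Q r y e = mfderiv 𝓘(ℝ, E n) (𝓡 d) (fun s => C (Q r) (g s) y) r e
  equivariant : ∀ ψ : R,
    ϖ.pullback (rightAct (ψ : Diffeo d M M)) (dSmooth_rightAct _) = transform (fun φ => C φ ψ) ϖ

end Bundle

end FieldSpace

open FieldSpace Diffeology

/-! A field-dependent $\psi$ differs from a fixed one only through an extra vertical velocity. For a
plot $P$, the plot $\Xi\circ P$ is the diagonal of $(s,t)\mapsto R_{\psi(P(s))}P(t)$. Its velocity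
at $r$ splits into a $t$-part, that of $R_{\psi(P(r))}\circ P$, which equivariance controls, and an
$s$-part, which is fundamental with generator $\psi(P(r))^{-1}\psi(P(s))$. A tensorial form kills
the $s$-part, and a connection sends it to $\psi^{-1}_*d\psi$. Hence
$\Xi^\star\alpha=\rho(\psi)^{-1}\alpha$ (`IsTensorial.pullback_vertical`) and
$\Xi^\star\omega=\psi^{-1}_*\omega\circ\psi+\psi^{-1}_*d\psi$ (`pullback_vertical_of_isEhresmann`).

Dressing has the same shape as these gauge transformations, and `transform` composes
(`transform_transform`). Since $\psi\circ(u\circ\Xi)=u\circ C(\psi)$, transforming $\omega$ by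
$\psi$ and then by $u\circ\Xi$ is the same as transforming it by $u$ and then by $C(\psi)$. For
tensorial forms, $\psi$ cancels in the representation. Equivariance under a fixed $\psi$ is the case
of a constant map.

Two points remain for connections: the value on vertical vectors, obtained by differentiating the
equivariance of $u$ (`dressConnection_vertical`), and smoothness (`isVForm_transform`). -/

namespace FieldSpace

/-! ### Smooth families of diffeomorphisms. -/

section PlotDiffeo

variable {d : ℕ} {M N K : Type*} [TopologicalSpace M] [ChartedSpace (E d) M]
  [TopologicalSpace N] [ChartedSpace (E d) N] [TopologicalSpace K] [ChartedSpace (E d) K]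

theorem isPlot_diffeo_iff {n : ℕ} {p : E n → Diffeo d M N} :
    IsPlot p ↔
      ContMDiff (𝓘(ℝ, E n).prod (𝓡 d)) (𝓡 d) ∞ (fun q : E n × M => p q.1 q.2) ∧
      ContMDiff (𝓘(ℝ, E n).prod (𝓡 d)) (𝓡 d) ∞ (fun q : E n × N => (p q.1).symm q.2) := by
  change JointlySmoothOn d Set.univ (fun r => p r) ∧
    JointlySmoothOn d Set.univ (fun r => (p r).symm) ↔ _
  simp only [JointlySmoothOn, Set.univ_prod_univ, contMDiffOn_univ]

theorem isPlot_diffeo_symm {n : ℕ} {p : E n → Diffeo d M N} (hp : IsPlot p) :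
    IsPlot fun r => (p r).symm :=
  isPlot_diffeo_iff.2 (isPlot_diffeo_iff.1 hp).symm

theorem isPlot_diffeo_trans {n : ℕ} {p : E n → Diffeo d M N} {q : E n → Diffeo d N K}
    (hp : IsPlot p) (hq : IsPlot q) : IsPlot fun r => (p r).trans (q r) := by
  obtain ⟨hp, hp'⟩ := isPlot_diffeo_iff.1 hp
  obtain ⟨hq, hq'⟩ := isPlot_diffeo_iff.1 hq
  exact isPlot_diffeo_iff.2
    ⟨hq.comp (contMDiff_fst.prodMk hp), hp'.comp (contMDiff_fst.prodMk hq')⟩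

theorem isPlot_diffeo_eval {n : ℕ} {p : E n → Diffeo d M N} (hp : IsPlot p) (x : M) :
    ContMDiff 𝓘(ℝ, E n) (𝓡 d) ∞ fun r => p r x :=
  (isPlot_diffeo_iff.1 hp).1.comp (contMDiff_id.prodMk contMDiff_const)

end PlotDiffeo

/-! ### Two-parameter plots and the splitting of vertical velocities. -/

section Action

variable {d : ℕ} {M : Type*} [TopologicalSpace M] [ChartedSpace (E d) M]
  {Φ : Type*} [MulAction (Diffeo d M M)ᵐᵒᵖ Φ]

@[simp] theorem rightAct_one (φ : Φ) : rightAct (1 : Diffeo d M M) φ = φ := by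
  simp [rightAct]

theorem rightAct_rightAct (g h : Diffeo d M M) (φ : Φ) :
    rightAct h (rightAct g φ) = rightAct (g * h) φ := by
  simp [rightAct, mul_smul]

variable [DiffeologicalSpace Φ] {n m : ℕ}

/-- The identification of `ℝⁿ × ℝᵐ` with `ℝⁿ⁺ᵐ`. -/
noncomputable def pairL (n m : ℕ) : (E n × E m) ≃L[ℝ] E (n + m) :=
  EuclideanSpace.finAddEquivProd.symm

/-- The projection `ℝⁿ⁺ᵐ → ℝⁿ`. -/
noncomputable def fstL (n m : ℕ) : E (n + m) →L[ℝ] E n :=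
  (ContinuousLinearMap.fst ℝ (E n) (E m)).comp (pairL n m).symm.toContinuousLinearMap

/-- The projection `ℝⁿ⁺ᵐ → ℝᵐ`. -/
noncomputable def sndL (n m : ℕ) : E (n + m) →L[ℝ] E m :=
  (ContinuousLinearMap.snd ℝ (E n) (E m)).comp (pairL n m).symm.toContinuousLinearMap

/-- The vector of `ℝⁿ⁺ᵐ` with the given components. -/
noncomputable def pairE (a : E n) (b : E m) : E (n + m) := pairL n m (a, b)

@[simp] theorem fstL_pairE (a : E n) (b : E m) : fstL n m (pairE a b) = a := by
  simp [fstL, pairE]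

@[simp] theorem sndL_pairE (a : E n) (b : E m) : sndL n m (pairE a b) = b := by
  simp [sndL, pairE]

theorem pairE_add (a a' : E n) (b b' : E m) :
    pairE (a + a') (b + b') = pairE a b + pairE a' b' := by
  rw [pairE, pairE, pairE, ← map_add, Prod.mk_add_mk]

theorem contDiff_pairE {k : ℕ} {a : E k → E n} {b : E k → E m} (ha : ContDiff ℝ ∞ a)
    (hb : ContDiff ℝ ∞ b) : ContDiff ℝ ∞ fun s => pairE (a s) (b s) :=
  (pairL n m).contDiff.comp (ha.prodMk hb)

theorem fderiv_pairE {k : ℕ} {a : E k → E n} {b : E k → E m} {r : E k}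
    (ha : DifferentiableAt ℝ a r) (hb : DifferentiableAt ℝ b r) (v : E k) :
    fderiv ℝ (fun s => pairE (a s) (b s)) r v = pairE (fderiv ℝ a r v) (fderiv ℝ b r v) := by
  have h : HasFDerivAt (fun s => pairE (a s) (b s))
      ((pairL n m).toContinuousLinearMap.comp ((fderiv ℝ a r).prod (fderiv ℝ b r))) r :=
    (pairL n m).toContinuousLinearMap.hasFDerivAt.comp r
      (ha.hasFDerivAt.prodMk hb.hasFDerivAt)
  rw [h.fderiv]
  rfl

theorem fderiv_pairE_diag (r v : E n) :
    fderiv ℝ (fun s : E n => pairE s s) r v = pairE v 0 + pairE 0 v := by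
  rw [fderiv_pairE differentiableAt_fun_id differentiableAt_fun_id, ← pairE_add]
  simp

theorem fderiv_pairE_right (r : E n) (t v : E m) :
    fderiv ℝ (fun s : E m => pairE r s) t v = pairE 0 v := by
  rw [fderiv_pairE (differentiableAt_const r) differentiableAt_fun_id]
  simp

theorem contDiff_pairE_diag : ContDiff ℝ ∞ fun s : E n => pairE s s :=
  contDiff_pairE contDiff_id contDiff_id

theorem contDiff_pairE_right (r : E n) : ContDiff ℝ ∞ fun s : E m => pairE r s :=
  contDiff_pairE contDiff_const contDiff_id

/-- The plot `(s, t) ↦ R_{g(s)} P(t)`. -/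
noncomputable def Plot.act [SmoothRightAction d M Φ] (P : Plot Φ m) (g : E n → Diffeo d M M)
    (hg : IsPlot g) : Plot Φ (n + m) :=
  ⟨fun z => rightAct (g (fstL n m z)) (P (sndL n m z)),
    SmoothRightAction.smooth (isPlot_reparam P.isPlot (sndL n m).contDiff)
      (isPlot_reparam hg (fstL n m).contDiff)⟩

variable [SmoothRightAction d M Φ]

/-- With `Plot.act_reparam_right`, this places the field-dependent and the frozen translation of `P`
inside one plot, where the reparametrisation law of forms can compare them. -/
theorem Plot.act_reparam_diag (P : Plot Φ n) {ψ : Φ → Diffeo d M M} (hψ : DSmooth ψ) :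
    (P.act (ψ ∘ P) (hψ n P P.isPlot)).reparam (fun s => pairE s s) contDiff_pairE_diag =
      P.map (vertical ψ) (dSmooth_vertical hψ) := by
  simp only [Plot.reparam, Plot.map, Plot.act, Plot.mk.injEq]
  ext s
  simp [vertical]

theorem Plot.act_reparam_right (P : Plot Φ m) {g : E n → Diffeo d M M} (hg : IsPlot g)
    (r : E n) :
    (P.act g hg).reparam (fun s => pairE r s) (contDiff_pairE_right r) =
      P.map (rightAct (g r)) (dSmooth_rightAct _) := by
  simp only [Plot.reparam, Plot.map, Plot.act, Plot.mk.injEq]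
  ext s
  simp

/-- Along the first factor, the velocity of `(s, t) ↦ R_{g(s)} P(t)` is fundamental. -/
theorem isFundamental_act (P : Plot Φ m) {g : E n → Diffeo d M M} (hg : IsPlot g) (r : E n)
    (t : E m) (v : E n) :
    IsFundamental (P.act g hg) (pairE r t) (pairE v 0)
      (fun z => (g r)⁻¹ * g (fstL n m z)) where
  isPlot := isPlot_diffeo_trans (isPlot_reparam hg (fstL n m).contDiff) isPlot_const
  base := by simp
  -- $R_{g(s)}=R_{g(r)^{-1}g(s)}\circ R_{g(r)}$, so the underlying plot is $R_{g(r)}\circ P$ in the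
  -- variable $t$, which is stationary in the direction $(v,0)$.
  exists_eq := ⟨m, P.map (rightAct (g r)) (dSmooth_rightAct _), sndL n m, (sndL n m).contDiff,
    by simp, fun z => by simp [Plot.act, Plot.map, rightAct_rightAct]⟩

end Action

/-! ### Tensorial forms and their dressing. -/

section Forms

/-- In the multilinear expansion, every term with at least one entry from `a` vanishes; only the
term indexed by the empty set survives. -/
theorem map_add_eq_of_horizontal {X V : Type*} [AddCommGroup X] [Module ℝ X]
    [AddCommGroup V] [Module ℝ V] {k : ℕ}
    (f : X [⋀^Fin k]→ₗ[ℝ] V) {a : Fin k → X}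
    (h : ∀ (v : Fin k → X) (i : Fin k), v i = a i → f v = 0) (b : Fin k → X) :
    f (a + b) = f b := by
  change f.toMultilinearMap (a + b) = f.toMultilinearMap b
  rw [MultilinearMap.map_add_univ, Finset.sum_eq_single ∅]
  · simp
  · intro s _ hs
    obtain ⟨i, hi⟩ := Finset.nonempty_iff_ne_empty.2 hs
    exact h _ i (by simp [hi])
  · simp


variable {d : ℕ} {M N : Type*} [TopologicalSpace M] [ChartedSpace (E d) M]
  [TopologicalSpace N] [ChartedSpace (E d) N]
  {Φ : Type*} [DiffeologicalSpace Φ] [MulAction (Diffeo d M M)ᵐᵒᵖ Φ] [SmoothRightAction d M Φ]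
  {V W : Type*} [AddCommGroup V] [Module ℝ V] [DiffeologicalSpace V]
  [AddCommGroup W] [Module ℝ W] [DiffeologicalSpace W] {k : ℕ}
  {ρ : NaturalRep d M N V W}

/-- A tensorial form transforms pointwise under a field-dependent diffeomorphism. -/
theorem IsTensorial.pullback_vertical {α : FormData Φ V k} (hα : IsTensorial ρ α)
    {ψ : Φ → Diffeo d M M} (hψ : DSmooth ψ) {n : ℕ} (P : Plot Φ n) (r : E n) :
    α.pullback (vertical ψ) (dSmooth_vertical hψ) P r =
      (ρ.onM (ψ (P r))⁻¹).compAlternatingMap (α P r) := by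
  have hg : IsPlot (ψ ∘ P) := hψ n P P.isPlot
  -- Both sides become `α` on the two-parameter plot at $(r,r)$, evaluated on the vectors
  -- $(v_i,v_i)$ and $(0,v_i)$; the differences $(v_i,0)$ are fundamental.
  rw [← hα.equivariant, FormData.pullback, FormData.pullback, ← P.act_reparam_diag hψ]
  change _ = α (P.map (rightAct ((ψ ∘ P) r)) _) r
  rw [← P.act_reparam_right hg r, hα.isForm.reparam, hα.isForm.reparam]
  ext v
  simp only [AlternatingMap.compLinearMap_apply, ContinuousLinearMap.coe_coe, fderiv_pairE_diag,
    fderiv_pairE_right]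
  exact map_add_eq_of_horizontal _ (fun w i hw =>
    hα.horizontal _ _ _ _ (isFundamental_act P hg r r (v i)) w i hw) _

/-- The factor $\psi$ cancels:
$\rho(\psi^{-1}uc)^{-1}\rho(\psi)^{-1}=\rho(uc)^{-1}=\rho(c)^{-1}\rho(u)^{-1}$. This trades
equivariance under $\psi$ for equivariance under the cocycle. -/
theorem NaturalRep.cross_symm_twist (ρ : NaturalRep d M N V W) (u : Diffeo d N M)
    (c : Diffeo d N N) (ψ : Diffeo d M M) (v : V) :
    (ρ.cross ((c.trans u).trans ψ⁻¹)).symm (ρ.onM ψ⁻¹ v) = ρ.onN c⁻¹ ((ρ.cross u).symm v) := by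
  rw [LinearEquiv.symm_apply_eq, ρ.cross_left, ρ.cross_right, ← Module.End.mul_apply, ← map_mul]
  simp

theorem IsTensorial.dressForm_pullback_vertical {R : Subgroup (Diffeo d M M)}
    {C : OneCocycle d M N Φ R} {u : Φ → Diffeo d N M}
    (hequiv : ∀ (ψ : R) (φ : Φ),
      u (rightAct (ψ : Diffeo d M M) φ) = ((C φ ψ).trans (u φ)).trans (ψ : Diffeo d M M)⁻¹)
    {α : FormData Φ V k} (hα : IsTensorial ρ α) (ψ : Φ → R)
    (hψ : DSmooth fun φ => (ψ φ : Diffeo d M M)) {n : ℕ} (P : Plot Φ n) (r : E n) :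
    (dressForm ρ u α).pullback (vertical fun φ => (ψ φ : Diffeo d M M))
        (dSmooth_vertical hψ) P r =
      (ρ.onN (C.along ψ (P r))⁻¹).compAlternatingMap (dressForm ρ u α P r) := by
  ext v
  have h := DFunLike.congr_fun (hα.pullback_vertical hψ P r) v
  simp only [FormData.pullback, LinearMap.compAlternatingMap_apply] at h
  simp only [FormData.pullback, dressForm, LinearMap.compAlternatingMap_apply, h]
  have e : (P.map (vertical fun φ => (ψ φ : Diffeo d M M)) (dSmooth_vertical hψ)) r =
    rightAct (ψ (P r) : Diffeo d M M) (P r) := rfl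
  rw [e, hequiv]
  exact ρ.cross_symm_twist _ _ _ _

omit [MulAction (Diffeo d M M)ᵐᵒᵖ Φ] [SmoothRightAction d M Φ] in
theorem isForm_dressForm {u : Φ → Diffeo d N M} (hu : DSmooth u) {α : FormData Φ V k}
    (hα : IsForm α) : IsForm (dressForm ρ u α) where
  smooth n P v := ρ.smooth_cross_symm (hu n P P.isPlot) (hα.smooth P v)
  reparam n m P f hf r := by
    ext v
    simp only [dressForm, LinearMap.compAlternatingMap_apply, hα.reparam]
    rfl

theorem IsTensorial.isTwistedTensorial_dressForm {R : Subgroup (Diffeo d M M)}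
    {C : OneCocycle d M N Φ R} {u : Φ → Diffeo d N M} (hu : DSmooth u)
    (hequiv : ∀ (ψ : R) (φ : Φ),
      u (rightAct (ψ : Diffeo d M M) φ) = ((C φ ψ).trans (u φ)).trans (ψ : Diffeo d M M)⁻¹)
    {α : FormData Φ V k} (hα : IsTensorial ρ α) :
    IsTwistedTensorial ρ C (dressForm ρ u α) where
  isForm := isForm_dressForm hu hα.isForm
  horizontal Q r e g hQ v i hv := by
    simp [dressForm, hα.horizontal Q r e _ hQ v i hv]
  equivariant ψ _ P r := hα.dressForm_pullback_vertical hequiv (fun _ => ψ) dSmooth_const P r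

end Forms

/-! ### Derivatives of families of maps between manifolds. -/

section Calculus

variable {d : ℕ} {M N : Type*} [TopologicalSpace M] [ChartedSpace (E d) M]
  [TopologicalSpace N] [ChartedSpace (E d) N] {n : ℕ}

/-- Chain rule through $s\mapsto(s,c(s))$, followed by the splitting into partial derivatives. It
serves as the product rule for compositions of families of diffeomorphisms. -/
theorem mfderiv_comp_graph {F : E n × M → N} {c : E n → M} {r : E n}
    (hF : MDifferentiableAt (𝓘(ℝ, E n).prod (𝓡 d)) (𝓡 d) F (r, c r))
    (hc : MDifferentiableAt 𝓘(ℝ, E n) (𝓡 d) c r) (v : E n) :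
    mfderiv 𝓘(ℝ, E n) (𝓡 d) (fun s => F (s, c s)) r v =
      (mfderiv 𝓘(ℝ, E n) (𝓡 d) (fun s => F (s, c r)) r v +
      mfderiv (𝓡 d) (𝓡 d) (fun x => F (r, x)) (c r)
        (mfderiv 𝓘(ℝ, E n) (𝓡 d) c r v) : TangentSpace (𝓡 d) (F (r, c r))) := by
  have hid : MDifferentiableAt 𝓘(ℝ, E n) 𝓘(ℝ, E n) (fun s : E n => s) r := mdifferentiableAt_id
  let w : TangentSpace (𝓘(ℝ, E n).prod (𝓡 d)) (r, c r) := (v, mfderiv 𝓘(ℝ, E n) (𝓡 d) c r v)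
  have h1 := mfderiv_comp_apply r (g := F) (f := fun s => (s, c s)) hF (hid.prodMk hc) v
  have h2 := mfderiv_prod_eq_add_apply (v := w) hF
  have h3 : mfderiv 𝓘(ℝ, E n) (𝓘(ℝ, E n).prod (𝓡 d)) (fun s => (s, c s)) r v = w := by
    rw [mfderiv_prodMk hid hc, show mfderiv 𝓘(ℝ, E n) 𝓘(ℝ, E n) (fun s : E n => s) r = _ from
      mfderiv_id]
    rfl
  rw [h3] at h1
  exact h1.trans h2

theorem mfderiv_diffeo_isInvertible (g : Diffeo d N M) (y : N) :
    (mfderiv (𝓡 d) (𝓡 d) g y).IsInvertible :=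
  ⟨g.mfderivToContinuousLinearEquiv (by simp) y, g.mfderivToContinuousLinearEquiv_coe (by simp)⟩

end Calculus

/-! ### The affine transformation law and its composition. -/

section VForms

variable {d : ℕ} {M N K : Type*} [TopologicalSpace M] [ChartedSpace (E d) M]
  [TopologicalSpace N] [ChartedSpace (E d) N] [TopologicalSpace K] [ChartedSpace (E d) K]
  {Φ : Type*} [DiffeologicalSpace Φ] {n : ℕ}

theorem mfderiv_conj_apply (g : Φ → Diffeo d N M) (A : VFormData Φ d M) (P : Plot Φ n) (r : E n)
    (y : N) (v : E n) :
    mfderiv (𝓡 d) (𝓡 d) (g (P r)) y (conj g A P r y v) = A P r (g (P r) y) v :=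
  (mfderiv_diffeo_isInvertible (g (P r)) y).self_apply_inverse _

theorem mfderiv_transform_apply (g : Φ → Diffeo d N M) (A : VFormData Φ d M) (P : Plot Φ n)
    (r : E n) (y : N) (v : E n) :
    mfderiv (𝓡 d) (𝓡 d) (g (P r)) y (transform g A P r y v) =
      (A P r (g (P r) y) v + mfderiv 𝓘(ℝ, E n) (𝓡 d) (fun s => g (P s) y) r v :
        TangentSpace (𝓡 d) (g (P r) y)) := by
  have h := mfderiv_diffeo_isInvertible (g (P r)) y
  change mfderiv (𝓡 d) (𝓡 d) (g (P r)) y (conj g A P r y v + maurerCartan g P r y v) = _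
  rw [map_add, mfderiv_conj_apply]
  exact congrArg _ (h.self_apply_inverse _)

/-- The derivative of a diffeomorphism is injective, so identities for `transform` can be checked
after push-forward by `g`, where no inverse appears. -/
theorem eq_transform_iff (g : Φ → Diffeo d N M) (A : VFormData Φ d M) (P : Plot Φ n)
    (r : E n) (y : N) (v : E n) (z : TangentSpace (𝓡 d) y) :
    z = transform g A P r y v ↔ mfderiv (𝓡 d) (𝓡 d) (g (P r)) y z =
      (A P r (g (P r) y) v + mfderiv 𝓘(ℝ, E n) (𝓡 d) (fun s => g (P s) y) r v :
        TangentSpace (𝓡 d) (g (P r) y)) := by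
  rw [← mfderiv_transform_apply, (mfderiv_diffeo_isInvertible (g (P r)) y).injective.eq_iff]

theorem VFormData.ext {A B : VFormData Φ d M}
    (h : ∀ {n : ℕ} (P : Plot Φ n) (r : E n) (x : M) (v : E n), A P r x v = B P r x v) : A = B := by
  funext n P r x
  exact ContinuousLinearMap.ext fun v => h P r x v

theorem mdifferentiableAt_diffeo (g : Diffeo d N M) (y : N) :
    MDifferentiableAt (𝓡 d) (𝓡 d) g y :=
  g.contMDiff.mdifferentiable (by simp) y

theorem mdifferentiableAt_plot {p : E n → Diffeo d N M} (hp : IsPlot p) (q : E n × N) :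
    MDifferentiableAt (𝓘(ℝ, E n).prod (𝓡 d)) (𝓡 d) (fun q : E n × N => p q.1 q.2) q :=
  (isPlot_diffeo_iff.1 hp).1.mdifferentiable (by simp) q

theorem mdifferentiableAt_plot_eval {p : E n → Diffeo d N M} (hp : IsPlot p) (y : N) (r : E n) :
    MDifferentiableAt 𝓘(ℝ, E n) (𝓡 d) (fun s => p s y) r :=
  (isPlot_diffeo_eval hp y).mdifferentiable (by simp) r

/-- The transformations compose: `g⁻¹_* (h⁻¹_* A ∘ h + h⁻¹_* dh) ∘ g + g⁻¹_* dg` is the transform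
of `A` by `h ∘ g`. -/
theorem transform_transform {g : Φ → Diffeo d N M} {h : Φ → Diffeo d M K} (hg : DSmooth g)
    (hh : DSmooth h) (A : VFormData Φ d K) :
    transform g (transform h A) = transform (fun φ => (g φ).trans (h φ)) A := by
  refine VFormData.ext fun {n} P r y v => (eq_transform_iff _ _ _ _ _ _ _).2 ?_
  have hgP : IsPlot (g ∘ P) := hg n P P.isPlot
  have hhP : IsPlot (h ∘ P) := hh n P P.isPlot
  have h1 := mfderiv_comp_apply y (g := h (P r)) (f := g (P r)) (mdifferentiableAt_diffeo _ _)
    (mdifferentiableAt_diffeo _ _) (transform g (transform h A) P r y v)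
  -- The product rule $d(h\circ g)=dh\circ g+h_*dg$ merges the two Maurer-Cartan terms.
  have h2 := mfderiv_comp_graph (F := fun q => h (P q.1) q.2) (c := fun s => g (P s) y) (r := r)
    (mdifferentiableAt_plot hhP _) (mdifferentiableAt_plot_eval hgP y r) v
  rw [mfderiv_transform_apply, map_add, mfderiv_transform_apply] at h1
  refine h1.trans ?_
  refine Eq.trans ?_ (congrArg (HAdd.hAdd (α := E d) (β := E d) (γ := E d) (A P r (h (P r) (g (P r) y)) v)) h2).symm
  exact add_assoc (G := E d) _ _ _

theorem transform_reparam {g : Φ → Diffeo d N M} (hg : DSmooth g) {A : VFormData Φ d M}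
    (hA : ∀ ⦃n m : ℕ⦄ (P : Plot Φ m) (f : E n → E m) (hf : ContDiff ℝ ∞ f) (r : E n) (x : M),
      A (P.reparam f hf) r x = (A P (f r) x).comp (fderiv ℝ f r))
    {m : ℕ} (P : Plot Φ m) (f : E n → E m) (hf : ContDiff ℝ ∞ f) (r : E n) (y : N) :
    transform g A (P.reparam f hf) r y = (transform g A P (f r) y).comp (fderiv ℝ f r) := by
  refine ContinuousLinearMap.ext fun v => Eq.symm ((eq_transform_iff _ _ _ _ _ _ _).2 ?_)
  have h1 := mfderiv_comp_apply r (g := fun s => g (P s) y) (f := f)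
    (mdifferentiableAt_plot_eval (hg m P P.isPlot) y (f r))
    (hf.contMDiff.mdifferentiable (by simp) r) v
  rw [mfderiv_eq_fderiv] at h1
  rw [hA]
  exact (mfderiv_transform_apply g A P (f r) y (fderiv ℝ f r v)).trans
    (congrArg (HAdd.hAdd (α := E d) (β := E d) (γ := E d) (A P (f r) (g (P (f r)) y) (fderiv ℝ f r v))) h1.symm)

theorem mfderiv_fst_prodMk {G : E n × M → N} {z : E n × M}
    (hG : MDifferentiableAt (𝓘(ℝ, E n).prod (𝓡 d)) (𝓡 d) G z)
    (w : TangentSpace (𝓘(ℝ, E n).prod (𝓡 d)) z) :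
    mfderiv (𝓘(ℝ, E n).prod (𝓡 d)) (𝓘(ℝ, E n).prod (𝓡 d)) (fun q : E n × M => (q.1, G q)) z w =
      ((w.1, mfderiv (𝓘(ℝ, E n).prod (𝓡 d)) (𝓡 d) G z w) : E n × E d) := by
  have hfst : MDifferentiableAt (𝓘(ℝ, E n).prod (𝓡 d)) 𝓘(ℝ, E n)
    (fun q : E n × M => q.1) z := mdifferentiableAt_fst
  rw [mfderiv_prodMk hfst hG,
    show mfderiv (𝓘(ℝ, E n).prod (𝓡 d)) 𝓘(ℝ, E n) (fun q : E n × M => q.1) z = _ from mfderiv_fst]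
  rfl

/-- The transform is the push-forward of the vector field `(-v, A(v))` on `ℝⁿ × M` by the family of
inverse diffeomorphisms. -/
theorem mfderiv_symm_eq_transform {g : Φ → Diffeo d N M} (hg : DSmooth g) (A : VFormData Φ d M)
    (P : Plot Φ n) (r : E n) (y : N) (v : E n) :
    (mfderiv (𝓘(ℝ, E n).prod (𝓡 d)) (𝓡 d) (fun q : E n × M => (g (P q.1)).symm q.2)
      (r, g (P r) y)
      ((-v, A P r (g (P r) y) v) :
        TangentSpace (𝓘(ℝ, E n).prod (𝓡 d)) (r, g (P r) y)) : E d) =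
      transform g A P r y v := by
  have hp : IsPlot (g ∘ P) := hg n P P.isPlot
  have hp' := isPlot_diffeo_symm hp
  let w : TangentSpace (𝓘(ℝ, E n).prod (𝓡 d)) (r, g (P r) y) := (-v, A P r (g (P r) y) v)
  let Z : TangentSpace (𝓡 d) y :=
    mfderiv (𝓘(ℝ, E n).prod (𝓡 d)) (𝓡 d) (fun q : E n × M => (g (P q.1)).symm q.2)
      (r, g (P r) y) w
  let w' : TangentSpace (𝓘(ℝ, E n).prod (𝓡 d)) (r, y) := (-v, Z)
  refine (eq_transform_iff g A P r y v Z).2 ?_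
  have hfst : MDifferentiableAt (𝓘(ℝ, E n).prod (𝓡 d)) 𝓘(ℝ, E n)
    (fun q : E n × M => q.1) (r, g (P r) y) := mdifferentiableAt_fst
  have hG : MDifferentiableAt (𝓘(ℝ, E n).prod (𝓡 d)) (𝓡 d)
    (fun q : E n × M => (g (P q.1)).symm q.2) (r, g (P r) y) := mdifferentiableAt_plot hp' _
  have hF : MDifferentiableAt (𝓘(ℝ, E n).prod (𝓡 d)) (𝓡 d)
    (fun q : E n × N => g (P q.1) q.2) (r, y) := mdifferentiableAt_plot hp (r, y)
  -- Differentiate $g_q(g_q^{-1}(x))=x$ in the direction $(-v,A(v))$: this gives $A(v)=-\partial_v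
  -- g+g_*Z$. The sign of $-v$ makes $dg$ enter $g_*Z$ with a plus.
  have h1 := mfderiv_comp_apply_of_eq (r, g (P r) y) (y := (r, y))
    (g := fun q : E n × N => g (P q.1) q.2)
    (f := fun q : E n × M => (q.1, (g (P q.1)).symm q.2))
    hF (hfst.prodMk hG) (by simp) w
  have h2 : (fun q : E n × N => g (P q.1) q.2) ∘
      (fun q : E n × M => (q.1, (g (P q.1)).symm q.2)) = Prod.snd := by
    ext q; simp
  have h3 : mfderiv (𝓘(ℝ, E n).prod (𝓡 d)) (𝓘(ℝ, E n).prod (𝓡 d))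
      (fun q : E n × M => (q.1, (g (P q.1)).symm q.2)) (r, g (P r) y) w = w' :=
    mfderiv_fst_prodMk hG w
  have h4 : mfderiv (𝓘(ℝ, E n).prod (𝓡 d)) (𝓡 d) (Prod.snd : E n × M → M) (r, g (P r) y) w =
      A P r (g (P r) y) v := by
    rw [mfderiv_snd]; rfl
  have h5 := mfderiv_prod_eq_add_apply (v := w') hF
  have h6 : mfderiv 𝓘(ℝ, E n) (𝓡 d) (fun s => g (P s) y) r (-v) =
      -mfderiv 𝓘(ℝ, E n) (𝓡 d) (fun s => g (P s) y) r v := map_neg _ _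
  have h7 : (A P r (g (P r) y) v : E d) =
      HAdd.hAdd (α := E d) (β := E d) (γ := E d)
        (mfderiv 𝓘(ℝ, E n) (𝓡 d) (fun s => g (P s) y) r (-v))
        (mfderiv (𝓡 d) (𝓡 d) (g (P r)) y Z) := by
    rw [h2, h3] at h1
    exact h4.symm.trans (h1.trans h5)
  rw [h6] at h7
  exact ((add_comm (G := E d) _ _).trans (eq_neg_add_iff_add_eq (G := E d).1 h7)).symm

end VForms

/-! ### Smoothness of the transform, and stationary parameters. -/

section VForms

variable {d : ℕ} {M N : Type*} [TopologicalSpace M] [ChartedSpace (E d) M]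
  [TopologicalSpace N] [ChartedSpace (E d) N]
  {Φ : Type*} [DiffeologicalSpace Φ]

theorem tangentBundle_ext {a b : TangentBundle (𝓡 d) M} (h : a.proj = b.proj)
    (h' : (a.snd : E d) = b.snd) : a = b := by
  obtain ⟨x, v⟩ := a
  obtain ⟨y, w⟩ := b
  obtain rfl : x = y := h
  exact congrArg _ h'

/-- Smoothness of the pointwise inverse of the derivative is never needed: by
`mfderiv_symm_eq_transform`, the transform is the tangent map of the smooth map $(r,x)\mapsto
g_r^{-1}(x)$ applied to the smooth family $(-v,A(v))$ at $(r,g_r(y))$. -/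
theorem isVForm_transform [IsManifold (𝓡 d) ∞ M] [IsManifold (𝓡 d) ∞ N] {g : Φ → Diffeo d N M}
    (hg : DSmooth g) {A : VFormData Φ d M} (hA : IsVForm A) : IsVForm (transform g A) where
  smooth n P v := by
    have hp : IsPlot (g ∘ P) := hg n P P.isPlot
    obtain ⟨hF, hG⟩ := isPlot_diffeo_iff.1 hp
    have : IsManifold (𝓡 d) 1 M := .of_le (n := ∞) (by simp)
    have hconst : ContMDiff 𝓘(ℝ, E n) 𝓘(ℝ, E n).tangent ∞
        (fun r => (⟨r, -v⟩ : TangentBundle 𝓘(ℝ, E n) (E n))) :=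
      contMDiff_vectorSpace_iff_contDiff.2 contDiff_const
    have hA' : ContMDiff (𝓘(ℝ, E n).prod (𝓡 d)) (𝓡 d).tangent ∞
        (fun q : E n × N => (⟨g (P q.1) q.2, A P q.1 (g (P q.1) q.2) v⟩ : TangentBundle (𝓡 d) M)) :=
      (hA.smooth P v).comp (contMDiff_fst.prodMk hF)
    have hs := (contMDiff_equivTangentBundleProd_symm (I := 𝓘(ℝ, E n)) (M := E n)
      (I' := 𝓡 d) (M' := M) (n := ∞)).comp ((hconst.comp contMDiff_fst).prodMk hA')
    refine ((hG.contMDiff_tangentMap (m := ∞) (by simp)).comp hs).congr fun q => ?_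
    exact tangentBundle_ext ((g (P q.1)).symm_apply_apply q.2).symm
      (mfderiv_symm_eq_transform hg A P q.1 q.2 v).symm
  reparam _ _ P f hf r y := transform_reparam hg hA.reparam P f hf r y

/-- A first derivative sees `f` only through its value and its derivative in the direction `e`. The
latter is zero, so `f` may be frozen at `r`. -/
theorem mfderiv_pairE_congr {n m : ℕ} {H : E (m + n) → M} {f : E n → E m} {r e : E n}
    (hH : MDifferentiableAt 𝓘(ℝ, E (m + n)) (𝓡 d) H (pairE (f r) r))
    (hf : DifferentiableAt ℝ f r) (he : fderiv ℝ f r e = 0) :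
    mfderiv 𝓘(ℝ, E n) (𝓡 d) (fun s => H (pairE (f s) s)) r e =
      mfderiv 𝓘(ℝ, E n) (𝓡 d) (fun s => H (pairE (f r) s)) r e := by
  have key (a : E n → E m) (ha : DifferentiableAt ℝ a r) (hae : fderiv ℝ a r e = 0)
      (har : a r = f r) : (mfderiv 𝓘(ℝ, E n) (𝓡 d) (fun s => H (pairE (a s) s)) r e : E d) =
        mfderiv 𝓘(ℝ, E (m + n)) (𝓡 d) H (pairE (f r) r) (pairE 0 e) := by
    have hd : DifferentiableAt ℝ (fun s => pairE (a s) s) r :=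
      (pairL m n).differentiableAt.comp r (ha.prodMk differentiableAt_fun_id)
    have h := mfderiv_comp_apply_of_eq r (y := pairE (f r) r) (g := H)
      (f := fun s => pairE (a s) s) hH hd.mdifferentiableAt (by rw [har]) e
    refine h.trans (congrArg _ ?_)
    rw [mfderiv_eq_fderiv]
    exact (fderiv_pairE ha differentiableAt_fun_id e).trans (by rw [hae]; simp)
  exact (key f hf he rfl).trans (key _ (differentiableAt_const _) (by simp) rfl).symm

/-! ### Ehresmann connections and their dressing. -/

variable [MulAction (Diffeo d M M)ᵐᵒᵖ Φ] [SmoothRightAction d M Φ]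

/-- A field-dependent diffeomorphism acts on an Ehresmann connection as a gauge transformation. -/
theorem pullback_vertical_of_isEhresmann [IsManifold (𝓡 d) ∞ M] {A : VFormData Φ d M}
    (hA : IsEhresmann A) {ψ : Φ → Diffeo d M M} (hψ : DSmooth ψ) :
    A.pullback (vertical ψ) (dSmooth_vertical hψ) = transform ψ A := by
  refine VFormData.ext fun {n} P r x v => ?_
  have hg : IsPlot (ψ ∘ P) := hψ n P P.isPlot
  have h1 : A.pullback (vertical ψ) (dSmooth_vertical hψ) P r x v =
      A (P.act (ψ ∘ P) hg) (pairE r r) x (pairE v 0) +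
        A (P.act (ψ ∘ P) hg) (pairE r r) x (pairE 0 v) := by
    rw [VFormData.pullback, ← P.act_reparam_diag hψ, hA.isVForm.reparam, ← map_add,
      ← fderiv_pairE_diag r v]
    rfl
  have h2 : A (P.act (ψ ∘ P) hg) (pairE r r) x (pairE 0 v) = conj (fun _ => ψ (P r)) A P r x v := by
    rw [← hA.equivariant, VFormData.pullback]
    change _ = A (P.map (rightAct ((ψ ∘ P) r)) _) r x v
    rw [← P.act_reparam_right hg r, hA.isVForm.reparam, ← fderiv_pairE_right r r v]
    rfl
  -- The $s$-part of the velocity contributes the velocity of $\psi(P(r))^{-1}\psi(P(s))$ at $x$;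
  -- pushed forward by $\psi(P(r))$, it becomes the derivative of $\psi(P(s))(x)$.
  have h3 := hA.vertical _ _ _ _ (isFundamental_act P hg r r v) x
  rw [h1, h2, h3, eq_transform_iff]
  refine (map_add (mfderiv (𝓡 d) (𝓡 d) (ψ (P r)) x) _ _).trans ?_
  refine Eq.trans ?_ (add_comm (G := E d) _ _)
  refine congrArg₂ (HAdd.hAdd (α := E d) (β := E d) (γ := E d)) ?_
    (mfderiv_conj_apply (fun _ => ψ (P r)) A P r x v)
  have hfund := isFundamental_act P hg r r v
  have e0 : ((ψ ∘ P) r)⁻¹ * (ψ ∘ P) (fstL n n (pairE r r)) = 1 := hfund.base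
  have h4 := mfderiv_comp_apply_of_eq (pairE r r) (y := x) (g := ψ (P r))
    (f := fun z => (((ψ ∘ P) r)⁻¹ * (ψ ∘ P) (fstL n n z)) x)
    (mdifferentiableAt_diffeo _ _) (mdifferentiableAt_plot_eval hfund.isPlot x _)
    (by rw [e0]; rfl) (pairE v 0)
  refine h4.symm.trans ?_
  have h5 : (ψ (P r) ∘ fun z => (((ψ ∘ P) r)⁻¹ * (ψ ∘ P) (fstL n n z)) x) =
      (fun s => ψ (P s) x) ∘ fstL n n := by
    ext z
    exact (ψ (P r)).apply_symm_apply _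
  have h6 := mfderiv_comp_apply_of_eq (pairE r r) (y := r) (g := fun s => ψ (P s) x)
    (f := fstL n n) (mdifferentiableAt_plot_eval hg x r)
    (fstL n n).differentiableAt.mdifferentiableAt (fstL_pairE r r) (pairE v 0)
  rw [h5]
  refine h6.trans (congrArg _ ?_)
  rw [mfderiv_eq_fderiv, ContinuousLinearMap.fderiv]
  exact fstL_pairE v 0

variable {R : Subgroup (Diffeo d M M)} {C : OneCocycle d M N Φ R} {u : Φ → Diffeo d N M}

omit [SmoothRightAction d M Φ] in
theorem OneCocycle.dSmooth_along (C : OneCocycle d M N Φ R) {ψ : Φ → R}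
    (hψ : DSmooth fun φ => (ψ φ : Diffeo d M M)) : DSmooth (C.along ψ) :=
  fun n _ hP => C.smooth hP (hψ n _ hP)

-- An idempotent of a group is trivial. Hence $C(\varphi;g(s))$ passes through the identity where
-- $g$ does.
omit [SmoothRightAction d M Φ] in
theorem OneCocycle.map_one (C : OneCocycle d M N Φ R) (φ : Φ) : C φ 1 = 1 := by
  have h := C.cocycle φ 1 1
  rwa [mul_one, OneMemClass.coe_one, rightAct_one, left_eq_mul] at h

theorem dressConnection_pullback_vertical [IsManifold (𝓡 d) ∞ M] (hu : DSmooth u)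
    (hequiv : ∀ (ψ : R) (φ : Φ),
      u (rightAct (ψ : Diffeo d M M) φ) = ((C φ ψ).trans (u φ)).trans (ψ : Diffeo d M M)⁻¹)
    {A : VFormData Φ d M} (hA : IsEhresmann A) (ψ : Φ → R)
    (hψ : DSmooth fun φ => (ψ φ : Diffeo d M M)) :
    (dressConnection u A).pullback (vertical fun φ => (ψ φ : Diffeo d M M))
      (dSmooth_vertical hψ) = transform (C.along ψ) (dressConnection u A) := by
  have h1 : (dressConnection u A).pullback (vertical fun φ => (ψ φ : Diffeo d M M))
      (dSmooth_vertical hψ) = transform (u ∘ vertical fun φ => (ψ φ : Diffeo d M M))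
        (A.pullback (vertical fun φ => (ψ φ : Diffeo d M M)) (dSmooth_vertical hψ)) := rfl
  rw [h1, pullback_vertical_of_isEhresmann hA hψ, transform_transform (hu.comp (dSmooth_vertical hψ)) hψ,
    dressConnection, transform_transform (C.dSmooth_along hψ) hu]
  -- Both sides are now transforms of the same `A`; what is left is $\psi\circ(u\circ\Xi)=u\circ
  -- C(\psi)$.
  congr 1
  funext φ
  ext y
  change (ψ φ : Diffeo d M M) (u (rightAct (ψ φ : Diffeo d M M) φ) y) = u φ (C φ (ψ φ) y)
  rw [hequiv]
  exact (ψ φ : Diffeo d M M).apply_symm_apply _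

/-- Differentiate $g(s)\circ u(Q(s))=u(P(f(s)))\circ C(P(f(s));g(s))$ at $r$ in the direction `e`.
As $g(r)=\mathrm{id}$, the left side gives $\omega(X^v)\circ u+du$; as $f$ is stationary, the right
side gives $u_*$ of the velocity of $C(Q(r);g(s))$. -/
theorem dressConnection_vertical [IsManifold (𝓡 d) ∞ M] (hu : DSmooth u)
    (hequiv : ∀ (ψ : R) (φ : Φ),
      u (rightAct (ψ : Diffeo d M M) φ) = ((C φ ψ).trans (u φ)).trans (ψ : Diffeo d M M)⁻¹)
    {A : VFormData Φ d M} (hA : IsEhresmann A) {n : ℕ} {Q : Plot Φ n} {r e : E n} {g : E n → R}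
    (hQ : IsFundamental Q r e (fun s => (g s : Diffeo d M M))) (y : N) :
    dressConnection u A Q r y e =
      mfderiv 𝓘(ℝ, E n) (𝓡 d) (fun s => C (Q r) (g s) y) r e := by
  obtain ⟨m, P, f, hf, hfe, hQP⟩ := hQ.exists_eq
  have hg1 : g r = 1 := Subtype.ext hQ.base
  have hQr : Q r = P (f r) := by rw [hQP, hQ.base, rightAct_one]
  have hC1 : C (Q r) (g r) y = y := by rw [hg1, C.map_one]; rfl
  have huQ : IsPlot (u ∘ Q) := hu n Q Q.isPlot
  have huP : IsPlot (u ∘ P) := hu m P P.isPlot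
  have hCQ : IsPlot fun s => C (Q r) (g s) := C.smooth isPlot_const hQ.isPlot
  refine Eq.symm ((eq_transform_iff u A Q r y e
    (mfderiv 𝓘(ℝ, E n) (𝓡 d) (fun s => C (Q r) (g s) y) r e : E d)).2 ?_)
  have h1 := mfderiv_comp_apply_of_eq r (y := y) (g := u (Q r)) (f := fun s => C (Q r) (g s) y)
    (mdifferentiableAt_diffeo _ _) (mdifferentiableAt_plot_eval hCQ y r) hC1 e
  refine h1.symm.trans ?_
  -- both sides are derivatives of `s ↦ g s (u (Q s) y)`
  have h2 := mfderiv_comp_graph (F := fun q => (g q.1 : Diffeo d M M) q.2)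
    (c := fun s => u (Q s) y) (r := r)
    (mdifferentiableAt_plot hQ.isPlot _) (mdifferentiableAt_plot_eval huQ y r) e
  have h3 : mfderiv (𝓡 d) (𝓡 d) (fun x => (g r : Diffeo d M M) x) (u (Q r) y) =
      ContinuousLinearMap.id ℝ (E d) := by
    have : (fun x => (g r : Diffeo d M M) x) = id := by rw [hg1]; rfl
    rw [this]
    exact mfderiv_id
  have h4 : (fun s => (g s : Diffeo d M M) (u (Q s) y)) =
      fun s => u (P (f s)) (C (P (f s)) (g s) y) := by
    funext s
    rw [hQP, hequiv]
    exact (g s : Diffeo d M M).apply_symm_apply _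
  -- Separating the variable of $P$ from that of $g$ gives a jointly smooth family in which $f(s)$
  -- can be replaced by $f(r)$.
  have hK : IsPlot fun z : E (m + n) =>
      (C (P (fstL m n z)) (g (sndL m n z))).trans (u (P (fstL m n z))) :=
    isPlot_diffeo_trans
      (C.smooth (isPlot_reparam P.isPlot (fstL m n).contDiff)
        (isPlot_reparam hQ.isPlot (sndL m n).contDiff))
      (isPlot_reparam huP (fstL m n).contDiff)
  have h5 := mfderiv_pairE_congr (mdifferentiableAt_plot_eval hK y (pairE (f r) r))
    (hf.differentiable (by simp) r) hfe
  have h6 : (fun s => u (P (f s)) (C (P (f s)) (g s) y)) = fun s =>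
      (C (P (fstL m n (pairE (f s) s))) (g (sndL m n (pairE (f s) s)))).trans
        (u (P (fstL m n (pairE (f s) s)))) y := by
    funext s; simp
  have h7 : (u (Q r) ∘ fun s => C (Q r) (g s) y) = fun s =>
      (C (P (fstL m n (pairE (f r) s))) (g (sndL m n (pairE (f r) s)))).trans
        (u (P (fstL m n (pairE (f r) s)))) y := by
    funext s; simp [hQr]
  refine Eq.trans (b := (mfderiv 𝓘(ℝ, E n) (𝓡 d) (fun s => (g s : Diffeo d M M) (u (Q s) y)) r e :
    E d)) ?_ ?_
  · rw [h4, h6, h7]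
    exact h5.symm
  rw [h3] at h2
  refine h2.trans ?_
  exact congrArg₂ (HAdd.hAdd (α := E d) (β := E d) (γ := E d))
    (hA.vertical Q r e _ hQ (u (Q r) y)).symm rfl

theorem isTwistedConnection_dressConnection [IsManifold (𝓡 d) ∞ M]
    [IsManifold (𝓡 d) ∞ N] (hu : DSmooth u)
    (hequiv : ∀ (ψ : R) (φ : Φ),
      u (rightAct (ψ : Diffeo d M M) φ) = ((C φ ψ).trans (u φ)).trans (ψ : Diffeo d M M)⁻¹)
    {A : VFormData Φ d M} (hA : IsEhresmann A) :
    IsTwistedConnection C (dressConnection u A) where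
  isVForm := isVForm_transform hu hA.isVForm
  vertical _ _ _ _ hQ y := dressConnection_vertical hu hequiv hA hQ y
  equivariant ψ := dressConnection_pullback_vertical hu hequiv hA (fun _ => ψ) dSmooth_const

end VForms

end FieldSpace

theorem proposition2 {d : ℕ} {M N : Type*}
    [TopologicalSpace M] [ChartedSpace (E d) M] [IsManifold (𝓡 d) ∞ M]
    [TopologicalSpace N] [ChartedSpace (E d) N] [IsManifold (𝓡 d) ∞ N]
    {Φ : Type*} [DiffeologicalSpace Φ] [MulAction (Diffeo d M M)ᵐᵒᵖ Φ] [SmoothRightAction d M Φ]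
    {V W : Type*} [AddCommGroup V] [Module ℝ V] [DiffeologicalSpace V] [DiffeologicalModule V]
    [AddCommGroup W] [Module ℝ W] [DiffeologicalSpace W] [DiffeologicalModule W]
    (ρ : NaturalRep d M N V W) (R : Subgroup (Diffeo d M M))
    (C : OneCocycle d M N Φ R) (u : Φ → Diffeo d N M) (hu : DSmooth u)
    (hequiv : ∀ (ψ : R) (φ : Φ),
      u (rightAct (ψ : Diffeo d M M) φ) = ((C φ ψ).trans (u φ)).trans (ψ : Diffeo d M M)⁻¹) :
    (∀ (k : ℕ) (α : FormData Φ V k), IsTensorial ρ α →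
      IsTwistedTensorial ρ C (dressForm ρ u α) ∧
      ∀ (ψ : Φ → R) (hψ : DSmooth fun φ => (ψ φ : Diffeo d M M)) {n : ℕ} (P : Plot Φ n) (r : E n),
        (dressForm ρ u α).pullback (vertical fun φ => (ψ φ : Diffeo d M M))
            (dSmooth_vertical hψ) P r =
          (ρ.onN (C.along ψ (P r))⁻¹).compAlternatingMap (dressForm ρ u α P r)) ∧
    (∀ A : VFormData Φ d M, IsEhresmann A →
      IsTwistedConnection C (dressConnection u A) ∧
      ∀ (ψ : Φ → R) (hψ : DSmooth fun φ => (ψ φ : Diffeo d M M)),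
        (dressConnection u A).pullback (vertical fun φ => (ψ φ : Diffeo d M M))
            (dSmooth_vertical hψ) =
          transform (C.along ψ) (dressConnection u A)) := by
  refine ⟨fun k α hα => ⟨hα.isTwistedTensorial_dressForm hu hequiv, fun ψ hψ _ P r =>
    hα.dressForm_pullback_vertical hequiv ψ hψ P r⟩, fun A hA =>
    ⟨isTwistedConnection_dressConnection hu hequiv hA, fun ψ hψ =>
      dressConnection_pullback_vertical hu hequiv hA ψ hψ⟩⟩
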